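/- \textbf{Theorem (Giraud's Theorem).} Let $\mathcal{E}$ be a (locally small) locally presentable category. The following are equivalent. \begin{enumerate} \item $\mathcal{E}$ satisfies \emph{weak descent}, that is, the following three conditions: \begin{itemize} \item (Universal colimits) For every small diagram $X : I \to \mathcal{E}$ and every morphism $Y \to \operatorname{colim}_i X_i$, the projections exhibit $Y$ as the colimit $\operatorname{colim}_i \left( Y \times_{\operatorname{colim}_i X_i} X_i \right)$. \item (Effective coproducts) For every small family of morphisms $\{ f_i : X_i \to Y_i \}_{i \in I}$, with $X = \sum_i X_i$, $Y = \sum_i Y_i$ and $f = \sum_i f_i : X \to Y$, the natural maps $X_i \to Y_i \times_Y X$ are isomorphisms. \item (Weakly effective pushouts) For every morphism $(f_0, f_1, f_2)$ of spans from $X_0 \leftarrow X_1 \to X_2$ to $Y_0 \leftarrow Y_1 \to Y_2$ both of whose squares are pullbacks, with $X = X_0 +_{X_1} X_2$, $Y = Y_0 +_{Y_1} Y_2$ and $f : X \to Y$ the induced map, the natural maps $X_i \to Y_i \times_Y X$ ($i = 0, 1, 2$) are effective epimorphisms, i.e. coequalizers of their kernel pairs. \end{itemize} \item $\mathcal{E}$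 satisfies \emph{Giraud's axioms}: \begin{itemize} \item (Disjoint coproducts) For all objects $X, Y$ of $\mathcal{E}$, the square formed by the coproduct inclusions $X \to X + Y \leftarrow Y$ and the unique maps $X \leftarrow \varnothing \to Y$ from the initial object $\varnothing$ is a pullback. \item (Universal colimits) For every morphism $f : X \to Y$ of $\mathcal{E}$, the pullback functor $f^* : \mathcal{E}_{/Y} \to \mathcal{E}_{/X}$ preserves small colimits. \item (Effective equivalence relations) Every equivalence relation $s, t : R \rightrightarrows X$ in $\mathcal{E}$ (a jointly monic pair that is reflexive, symmetric and transitive) is the kernel pair of its coequalizer $X \to X/R$. \end{itemize} \item $\mathcal{E}$ is a \emph{Grothendieck topos}: there are a small category $\mathcal{C}$ and a coverage $j$ on $\mathcal{C}$ such that $\mathcal{E}$ is equivalent to the category $\mathrm{Sh}(\mathcal{C}, j)$ of $j$-sheaves of sets. Here a coverage assigns to each object $U$ a set $j(U)$ of families of morphisms with codomain $U$, such that $\{1_U\} \in j(U)$ and such that for all $r \in j(U)$ and $g : V \to U$ there is $t \in j(V)$ for which $g t_k$ factors through a member of $r$ for every $t_k$ in $t$; and a $j$-sheaf is a presheaf $P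 : \mathcal{C}^{\mathrm{op}} \to \mathrm{Set}$ such that, for all $U$ and all $r \in j(U)$, every matching family for $r$ in $P$ has a unique amalgamation in $P(U)$. \end{enumerate} -/

import Mathlib

universe v u

namespace GiraudDescent

open CategoryTheory CategoryTheory.Limits

section LocallyPresentable

variable (E : Type u) [Category.{v} E] [IsLocallyPresentable.{v} E]

/-- A locally presentable category is cocomplete. -/
instance hasColimits_of_isLocallyPresentable : HasColimitsOfSize.{v, v} E := by
  obtain ⟨κ, _, _⟩ := IsLocallyPresentable.exists_cardinal.{v} E
  infer_instance

/-- A locally presentable category is complete, being reflective in a category of presheaves. -/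
theorem hasLimits_of_isLocallyPresentable : HasLimitsOfSize.{v, v} E := by
  obtain ⟨κ, _, _⟩ := IsLocallyPresentable.exists_cardinal.{v} E
  have : EssentiallySmall.{v} (isCardinalPresentable E κ).FullSubcategory := inferInstance
  let F : SmallModel.{v} (isCardinalPresentable E κ).FullSubcategory ⥤ E :=
    (equivSmallModel.{v} _).inverse ⋙ (isCardinalPresentable E κ).ι
  have : F.IsDense := inferInstance
  let R := Presheaf.restrictedULiftYoneda.{v} F
  have : R.IsRightAdjoint :=
    (Presheaf.uliftYonedaAdjunction.{v} _
      (uliftYoneda.{v}.leftKanExtensionUnit F)).isRightAdjoint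
  have : Reflective R := { L := R.leftAdjoint, adj := Adjunction.ofIsRightAdjoint R }
  exact hasLimits_of_reflective R

instance hasFiniteLimits_of_isLocallyPresentable : HasFiniteLimits E :=
  have := hasLimits_of_isLocallyPresentable E
  hasFiniteLimits_of_hasLimitsOfSize E

end LocallyPresentable

section Descent

variable (E : Type u) [Category.{v} E] [HasColimitsOfSize.{v, v} E] [HasFiniteLimits E]

/-- Small colimits are universal: for every small diagram `X` and every map `Y ⟶ colim X`, the
object `Y` is, via the projections, the colimit of the pullbacks `Y ×_{colim X} X i`. -/
def UniversalColimits : Prop :=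
  ∀ (J : Type v) [SmallCategory J] (X : J ⥤ E), IsUniversalColimit (colimit.cocone X)

/-- Small coproducts are effective: for every small family of maps `f i : X i ⟶ Y i`, the natural
maps `X i ⟶ Y i ×_{∐ Y} ∐ X` are isomorphisms. -/
def EffectiveCoproducts : Prop :=
  ∀ (ι : Type v) (X Y : ι → E) (f : ∀ i, X i ⟶ Y i) (i : ι),
    IsIso (pullback.lift (f i) (Sigma.ι X i) (by simp) :
      X i ⟶ pullback (Sigma.ι Y i) (Limits.Sigma.map f))

/-- Pushouts are weakly effective: for every map of spans
```
  X₀ ⟵ X₁ ⟶ X₂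
  |    |    |
  Y₀ ⟵ Y₁ ⟶ Y₂
```
whose two squares are pullbacks, the natural maps from `X₀`, `X₁` and `X₂` to the pullbacks of
`X = X₀ +_{X₁} X₂` along the canonical maps from `Y₀`, `Y₁` and `Y₂` to `Y = Y₀ +_{Y₁} Y₂` are
effective epimorphisms. -/
def WeaklyEffectivePushouts : Prop :=
  ∀ ⦃X₀ X₁ X₂ Y₀ Y₁ Y₂ : E⦄ (a : X₁ ⟶ X₀) (b : X₁ ⟶ X₂) (c : Y₁ ⟶ Y₀) (d : Y₁ ⟶ Y₂)
    (f₀ : X₀ ⟶ Y₀) (f₁ : X₁ ⟶ Y₁) (f₂ : X₂ ⟶ Y₂)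
    (h₀ : IsPullback a f₁ f₀ c) (h₂ : IsPullback b f₁ f₂ d),
    EffectiveEpi (pullback.lift f₀ (pushout.inl a b) (pushout.inl_desc _ _ _).symm :
      X₀ ⟶ pullback (pushout.inl c d) (pushout.map a b c d f₀ f₂ f₁ h₀.w h₂.w)) ∧
    EffectiveEpi (pullback.lift f₁ (a ≫ pushout.inl a b) 
      (by rw [Category.assoc, pushout.map, pushout.inl_desc, h₀.w_assoc]) :
      X₁ ⟶ pullback (c ≫ pushout.inl c d) (pushout.map a b c d f₀ f₂ f₁ h₀.w h₂.w)) ∧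
    EffectiveEpi (pullback.lift f₂ (pushout.inr a b) (pushout.inr_desc _ _ _).symm :
      X₂ ⟶ pullback (pushout.inr c d) (pushout.map a b c d f₀ f₂ f₁ h₀.w h₂.w))

/-- Weak descent. -/
structure WeakDescent : Prop where
  universalColimits : UniversalColimits E
  effectiveCoproducts : EffectiveCoproducts E
  weaklyEffectivePushouts : WeaklyEffectivePushouts E

/-- Giraud's axioms: disjoint coproducts, colimits preserved by pullback functors, and effective
equivalence relations (each is the kernel pair of its coequalizer). -/
structure GiraudAxioms : Prop where
  disjointCoproducts : ∀ X Y : E,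
    IsPullback (initial.to X) (initial.to Y) (coprod.inl : X ⟶ X ⨿ Y) (coprod.inr : Y ⟶ X ⨿ Y)
  pullbackPreservesColimits : ∀ ⦃X Y : E⦄ (f : X ⟶ Y),
    PreservesColimitsOfSize.{v, v} (Over.pullback f)
  effectiveEquivalenceRelations : ∀ ⦃R X : E⦄ (s t : R ⟶ X), IsEquivalenceRelation s t →
    IsKernelPair (coequalizer.π s t) s t

end Descent

/-- The presheaves of sets that are sheaves for every covering family of a coverage. -/
def IsCoverageSheaf {C : Type v} [SmallCategory C] (j : Coverage C) :
    ObjectProperty (Cᵒᵖ ⥤ Type v) :=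
  fun P => ∀ (U : C) (r : Presieve U), r ∈ j U → r.IsSheafFor P

/-- A Grothendieck topos is a category equivalent to the category of sheaves of sets on a small
site, that is a small category with a coverage containing the identity families. -/
def IsGrothendieckTopos (E : Type u) [Category.{v} E] : Prop :=
  ∃ (C : Type v) (_ : SmallCategory C) (j : Coverage C),
    (∀ U : C, Presieve.singleton (𝟙 U) ∈ j U) ∧
      Nonempty (E ≌ (IsCoverageSheaf j).FullSubcategory)

end GiraudDescent

/-! (1 ⇒ 2) Universality of colimits is preservation by pullback functors read in slices, and
disjointness is effectiveness for the family `∅ ⟶ X`, `𝟙 Y`. For an equivalence relation `R` on `X`,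
map the span `R ⟵ R ×_X R ⟶ R` to `X ⟵ R ⟶ X`. Both squares are pullbacks and the pushouts are `X`
and `X/R`, so `R ⟶ X ×_{X/R} X` is an effective epimorphism; it is also monic, hence invertible.

(2 ⇒ 3) Presentable objects of a suitable rank form a small dense full subcategory, and restricted
Yoneda embeds `E` fully faithfully in the sheaves on it for the topology induced by the canonical
one. Given a sheaf `P`, let `A` be the coproduct of objects indexed by the elements of `P`. Pairs of
sections of `A` that agree in `P` form a subsheaf of `A ⨯ A`; it is represented by an equivalence
relation in `E`, whose effective quotient represents `P` (`exists_iso_restrictedYoneda`).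

(3 ⇒ 1) A topos is reflective in presheaves with left exact reflector. The exactness needed holds in
sets, hence pointwise in presheaves, and the reflector transports it; for pushouts see
`exists_of_isPushout_of_isPullback` and `effectiveEpi_of_reflective`. -/

namespace GiraudDescent

open CategoryTheory CategoryTheory.Limits

/-! ### Universal colimits versus pullback functors on slices -/

section Universal

variable {E : Type u} [Category.{v} E] [HasPullbacks E]

theorem isPullback_overPullback_map_left {X Y : E} (f : X ⟶ Y) {A B : Over Y} (g : A ⟶ B) :
    IsPullback ((Over.pullback f).map g).left (pullback.fst A.hom f) (pullback.fst B.hom f)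
      g.left := by
  refine IsPullback.of_right (h₁₂ := pullback.snd B.hom f) (h₂₂ := B.hom) (v₁₃ := f) ?_
    (pullback.lift_fst _ _ _) (IsPullback.of_hasPullback B.hom f).flip
  have h₁ : ((Over.pullback f).map g).left ≫ pullback.snd B.hom f = pullback.snd A.hom f :=
    pullback.lift_snd _ _ _
  rw [h₁, Over.w g]
  exact (IsPullback.of_hasPullback A.hom f).flip

variable {J : Type*} [Category* J] [HasColimitsOfShape J E]

/-- Forgetting the base preserves and reflects colimits, so the claim is universality of the
underlying cocone along `c.pt ×_Y X ⟶ c.pt`. -/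
theorem preservesColimitsOfShape_overPullback
    (h : ∀ (F : J ⥤ E) (c : Cocone F), IsColimit c → IsUniversalColimit c) {X Y : E} (f : X ⟶ Y) :
    PreservesColimitsOfShape J (Over.pullback f) where
  preservesColimit {K} := ⟨fun {c} hc => by
    have hc' := isColimitOfPreserves (Over.forget Y) hc
    refine (h _ _ hc' ((Over.forget X).mapCocone ((Over.pullback f).mapCocone c))
      { app := fun j => pullback.fst (K.obj j).hom f
        naturality := fun i j g => pullback.lift_fst _ _ _ }
      (pullback.fst c.pt.hom f) ?_ ?_ ?_).map fun hc'' => isColimitOfReflects (Over.forget X) hc''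
    · ext j
      exact (pullback.lift_fst _ _ _).symm
    · intro i j g
      exact isPullback_overPullback_map_left f (K.map g)
    · intro j
      exact isPullback_overPullback_map_left f (c.ι.app j)⟩

/-- A colimit cocone is also a colimit in the slice over its own point, with apex `𝟙`; pulling this
back along `f` gives `c'` up to isomorphism. -/
theorem isUniversalColimit_of_preservesColimitsOfShape
    (h : ∀ {X Y : E} (f : X ⟶ Y), PreservesColimitsOfShape J (Over.pullback f))
    {F : J ⥤ E} {c : Cocone F} (hc : IsColimit c) : IsUniversalColimit c := by
  intro F' c' α f w _ hp
  have := h f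
  have hc₁ := isColimitOfPreserves (Over.forget _)
    (isColimitOfPreserves (Over.pullback f) (Over.isColimitToOver hc))
  let e : F' ≅ ((c.toCostructuredArrow ⋙ CostructuredArrow.toOver _ _) ⋙
      Over.pullback f) ⋙ Over.forget _ :=
    NatIso.ofComponents (fun j => (hp j).flip.isoPullback) (fun {i j} g => by
      apply pullback.hom_ext
      · refine ((Category.assoc _ _ _).trans
          (congrArg _ (IsPullback.isoPullback_hom_fst (hp j).flip))).trans ?_
        refine (α.naturality g).trans ?_
        refine Eq.trans ?_ (Category.assoc _ _ _).symm
        refine Eq.trans ?_ (congrArg _ (pullback.lift_fst _ _ _).symm)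
        exact ((IsPullback.isoPullback_hom_fst_assoc (hp i).flip (F.map g)).symm)
      · refine ((Category.assoc _ _ _).trans
          (congrArg _ (IsPullback.isoPullback_hom_snd (hp j).flip))).trans ?_
        refine (c'.w g).trans ?_
        refine Eq.trans ?_ (Category.assoc _ _ _).symm
        refine Eq.trans ?_ (congrArg _ (pullback.lift_snd _ _ _).symm)
        exact (IsPullback.isoPullback_hom_snd (hp i).flip).symm)
  have : IsIso (pullback.snd (𝟙 c.pt) f) := inferInstance
  refine ⟨(IsColimit.precomposeHomEquiv e.symm c').1 (hc₁.ofIsoColimit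
    (Cocone.ext (@asIso _ _ _ _ (pullback.snd (𝟙 c.pt) f) this) fun j => ?_))⟩
  refine (pullback.lift_snd _ _ _).trans ?_
  exact (IsPullback.isoPullback_inv_snd (hp j).flip).symm

end Universal

/-! ### Weak descent implies Giraud's axioms -/

section WeakDescentToGiraud

attribute [local simp] pullback.lift_fst pullback.lift_snd pullback.lift_fst_assoc
  pullback.lift_snd_assoc pushout.inl_desc pushout.inr_desc coprod.inl_desc coprod.inr_desc
  PullbackCone.IsLimit.lift_fst PullbackCone.IsLimit.lift_snd PullbackCone.IsLimit.lift_fst_assoc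
  PullbackCone.IsLimit.lift_snd_assoc

variable {E : Type u} [Category.{v} E]

theorem isPullback_of_isIso_lift [HasPullbacks E] {P X Y Z : E} {fst : P ⟶ X} {snd : P ⟶ Y}
    {f : X ⟶ Z} {g : Y ⟶ Z} {w : fst ≫ f = snd ≫ g} (h : IsIso (pullback.lift fst snd w)) :
    IsPullback fst snd f g :=
  IsPullback.of_iso_pullback ⟨w⟩ (asIso (pullback.lift fst snd w)) (by simp) (by simp)

variable {R X : E} {p₁ p₂ : R ⟶ X}

/-- On elements, `e.c` consists of chains `x ~ y ~ z`. Given `x ~ z` and `x ~ y`, symmetry and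
transitivity recover `y ~ z`. -/
theorem _root_.CategoryTheory.EquivalenceRelation.isPullback_t (e : EquivalenceRelation p₁ p₂) :
    IsPullback e.t e.c.fst p₁ p₁ := by
  have s₁ : e.s ≫ p₁ = p₂ := e.symmetry₁
  have s₂ : e.s ≫ p₂ = p₁ := e.symmetry₂
  have t₁ : e.t ≫ p₁ = e.c.fst ≫ p₁ := e.transitivity₁
  have t₂ : e.t ≫ p₂ = e.c.snd ≫ p₂ := e.transitivity₂
  let l (k : PullbackCone p₁ p₁) : k.pt ⟶ e.c.pt :=
    PullbackCone.IsLimit.lift e.isLimit (k.snd ≫ e.s) k.fst (by simp [s₂, k.condition])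
  have hl (k : PullbackCone p₁ p₁) : k.snd ≫ p₂ = (l k ≫ e.t) ≫ p₁ := by
    simp [l, t₁, s₁]
  refine ⟨⟨e.transitivity₁⟩, ⟨PullbackCone.IsLimit.mk e.transitivity₁
    (fun k => PullbackCone.IsLimit.lift e.isLimit k.snd (l k ≫ e.t) (hl k)) (fun k => ?_)
    (fun k => ?_) (fun k m h₁ h₂ => ?_)⟩⟩
  · apply e.right_cancellation
    · simp [t₁, k.condition]
    · simp [t₂, l]
  · simp
  · apply PullbackCone.IsLimit.hom_ext e.isLimit
    · simpa using h₂
    · apply e.right_cancellation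
      · rw [PullbackCone.IsLimit.lift_snd, ← hl, ← h₂]
        simp [e.c.condition]
      · simp [t₂, l, ← h₁]

theorem isPushout_of_reflexive {r : X ⟶ R} (h₁ : r ≫ p₁ = 𝟙 X) (h₂ : r ≫ p₂ = 𝟙 X)
    [HasCoequalizer p₁ p₂] :
    IsPushout p₁ p₂ (coequalizer.π p₁ p₂) (coequalizer.π p₁ p₂) := by
  have key (k : PushoutCocone p₁ p₂) : k.inl = k.inr := by
    simpa [reassoc_of% h₁, reassoc_of% h₂] using r ≫= k.condition
  refine ⟨⟨coequalizer.condition _ _⟩, ⟨PushoutCocone.IsColimit.mk _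
    (fun k => coequalizer.desc k.inl (by rw [k.condition, key])) ?_ ?_ ?_⟩⟩
  · simp
  · simp [key]
  · intro k m h _
    apply coequalizer.hom_ext
    simpa using h

theorem _root_.CategoryTheory.EquivalenceRelation.isPushout_t (e : EquivalenceRelation p₁ p₂) :
    IsPushout e.t e.c.snd p₂ p₂ := by
  have r₁ : e.r ≫ p₁ = 𝟙 X := e.reflexivity₁
  have r₂ : e.r ≫ p₂ = 𝟙 X := e.reflexivity₂
  have t₁ : e.t ≫ p₁ = e.c.fst ≫ p₁ := e.transitivity₁
  have t₂ : e.t ≫ p₂ = e.c.snd ≫ p₂ := e.transitivity₂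
  -- `l₁` sends `x ~ y` to `x ~ x ~ y`, forcing the two legs of a cocone to agree; `l₂` sends it to
  -- `x ~ y ~ y`, so the common leg depends on `y` only.
  let l₁ : R ⟶ e.c.pt := PullbackCone.IsLimit.lift e.isLimit (p₁ ≫ e.r) (𝟙 R) (by simp)
  let l₂ : R ⟶ e.c.pt := PullbackCone.IsLimit.lift e.isLimit (𝟙 R) (p₂ ≫ e.r) (by simp)
  have h₁ : l₁ ≫ e.t = 𝟙 R := by
    apply e.right_cancellation <;> simp [l₁, t₁, t₂, r₁]
  have h₁' : l₁ ≫ e.c.snd = 𝟙 R := by simp [l₁]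
  have h₂ : l₂ ≫ e.t = 𝟙 R := by
    apply e.right_cancellation <;> simp [l₂, t₁, t₂, r₂]
  have h₂' : l₂ ≫ e.c.snd = p₂ ≫ e.r := by simp [l₂]
  have key (k : PushoutCocone e.t e.c.snd) : k.inl = k.inr := by
    simpa [reassoc_of% h₁, reassoc_of% h₁'] using l₁ ≫= k.condition
  have key' (k : PushoutCocone e.t e.c.snd) : p₂ ≫ e.r ≫ k.inl = k.inl := by
    simpa [reassoc_of% h₂, reassoc_of% h₂', ← key] using (l₂ ≫= k.condition).symm
  refine ⟨⟨e.transitivity₂⟩, ⟨PushoutCocone.IsColimit.mk _ (fun k => e.r ≫ k.inl) key'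
    (fun k => by rw [key', key]) ?_⟩⟩
  intro k m h _
  simp [← h]

theorem isKernelPair_of_weaklyEffectivePushouts [HasColimitsOfSize.{v, v} E] [HasFiniteLimits E]
    (h : WeaklyEffectivePushouts E) (e : EquivalenceRelation p₁ p₂) :
    IsKernelPair (coequalizer.π p₁ p₂) p₁ p₂ := by
  obtain ⟨h₀, -, -⟩ := h e.t e.c.snd p₁ p₂ p₁ e.c.fst p₁ e.isPullback_t
    (IsPullback.of_isLimit e.isLimit).flip
  have po₁ := isPushout_of_reflexive e.reflexivity₁ e.reflexivity₂
  have po₂ := e.isPushout_t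
  let l : R ⟶ pullback (pushout.inl p₁ p₂) (pushout.map e.t e.c.snd p₁ p₂ p₁ p₁ e.c.fst
      e.isPullback_t.w (IsPullback.of_isLimit e.isLimit).flip.w) :=
    pullback.lift p₁ (pushout.inl e.t e.c.snd) (pushout.inl_desc _ _ _).symm
  have : Mono l := ⟨fun u w huw => by
    apply e.right_cancellation
    · simpa [l] using huw =≫ pullback.fst _ _
    · have := (huw =≫ pullback.snd _ _) =≫ po₂.isoPushout.inv
      simpa [l] using this⟩
  have hi : IsIso l := isIso_of_mono_of_strongEpi l
  refine (isPullback_of_isIso_lift hi).of_iso (Iso.refl _) (Iso.refl _) po₂.isoPushout.symm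
    po₁.isoPushout.symm ?_ ?_ ?_ ?_
  · simp
  · simp
  · simp
  · apply pushout.hom_ext <;> simp [pushout.map, pushout.inl_desc_assoc, pushout.inr_desc_assoc]
      <;> exact coequalizer.condition _ _

theorem isPullback_initial_of_effectiveCoproducts [HasColimitsOfSize.{v, v} E] [HasFiniteLimits E]
    (h : EffectiveCoproducts E) (X Y : E) :
    IsPullback (initial.to X) (initial.to Y) (coprod.inl : X ⟶ X ⨿ Y) coprod.inr := by
  -- The families are `∅ ⟶ X` and `𝟙 Y`, so the induced map of coproducts is `coprod.inr` up to
  -- isomorphism.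
  let A : ULift.{v} Bool → E := fun i => i.down.rec Y (⊥_ E)
  let B : ULift.{v} Bool → E := fun i => i.down.rec Y X
  let f : ∀ i, A i ⟶ B i := fun i => match i with
    | ⟨false⟩ => 𝟙 Y
    | ⟨true⟩ => initial.to X
  have hi := h _ A B f ⟨true⟩
  let e₁ : ∐ A ≅ Y :=
    { hom := Sigma.desc fun i => match i with
        | ⟨false⟩ => 𝟙 Y
        | ⟨true⟩ => initial.to Y
      inv := Sigma.ι A ⟨false⟩
      hom_inv_id := by
        apply Sigma.hom_ext
        rintro ⟨_ | _⟩
        · simp only [colimit.ι_desc_assoc]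
          exact (Category.id_comp _).trans (Category.comp_id _).symm
        · exact initial.hom_ext _ _
      inv_hom_id := by simp }
  let e₂ : ∐ B ≅ X ⨿ Y :=
    { hom := Sigma.desc fun i => match i with
        | ⟨false⟩ => coprod.inr
        | ⟨true⟩ => coprod.inl
      inv := coprod.desc (Sigma.ι B ⟨true⟩) (Sigma.ι B ⟨false⟩)
      hom_inv_id := by
        apply Sigma.hom_ext
        rintro ⟨_ | _⟩ <;> simp
      inv_hom_id := by apply coprod.hom_ext <;> simp <;> rfl }
  refine (isPullback_of_isIso_lift hi).of_iso (Iso.refl _) (Iso.refl _) e₁ e₂ ?_ ?_ ?_ ?_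
  · exact initial.hom_ext _ _
  · exact initial.hom_ext _ _
  · simp [e₂]
    rfl
  · apply Sigma.hom_ext
    rintro ⟨_ | _⟩
    · simp [e₁, e₂, f]
      rfl
    · exact initial.hom_ext _ _

theorem WeakDescent.giraudAxioms [HasColimitsOfSize.{v, v} E] [HasFiniteLimits E]
    (h : WeakDescent E) : GiraudAxioms E where
  disjointCoproducts := isPullback_initial_of_effectiveCoproducts h.effectiveCoproducts
  pullbackPreservesColimits _ _ f :=
    ⟨fun {J} _ => preservesColimitsOfShape_overPullback (fun F _ hc =>
      (h.universalColimits J F).of_iso ((colimit.isColimit F).uniqueUpToIso hc)) f⟩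
  effectiveEquivalenceRelations _ _ _ _ hR :=
    isKernelPair_of_weaklyEffectivePushouts h.weaklyEffectivePushouts
      hR.nonempty_equivalenceRelation.some

end WeakDescentToGiraud

/-! ### Universal colimits are canonical covers -/

section CanonicalCovers

variable {E : Type u} [Category.{v} E]

/-- The arrows into the point of a cocone that factor through one of its legs. -/
def coconeSieve {J : Type*} [Category* J] {G : J ⥤ E} (c : Cocone G) : Sieve c.pt where
  arrows Y f := ∃ (j : J) (h : Y ⟶ G.obj j), h ≫ c.ι.app j = f
  downward_closed := by
    rintro Y Z f ⟨j, h, rfl⟩ g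
    exact ⟨j, g ≫ h, by simp⟩

theorem coconeSieve_mem_canonicalTopology [HasPullbacks E] {J : Type*} [Category* J] {G : J ⥤ E}
    {c : Cocone G} (hc : IsUniversalColimit c) :
    coconeSieve c ∈ Sheaf.canonicalTopology E c.pt := by
  refine Sheaf.mem_finestTopology_of_forall_isSheafFor ?_
  rintro _ ⟨W, rfl⟩ Y f
  -- By universality `Y` is the colimit of the pulled-back legs, so a matching family, restricted to
  -- these legs, is a cocone with a unique descent.
  let G' : J ⥤ E :=
    { obj := fun j => pullback f (c.ι.app j)
      map := fun {i j} u => pullback.lift (pullback.fst _ _) (pullback.snd _ _ ≫ G.map u)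
        (by simp [pullback.condition])
      map_id := fun j => by
        apply pullback.hom_ext
        · simp
        · simp
      map_comp := fun u w => by
        apply pullback.hom_ext
        · simp [pullback.lift_fst]
        · simp [pullback.lift_snd, pullback.lift_snd_assoc] }
  let c' : Cocone G' :=
    { pt := Y
      ι := { app := fun j => pullback.fst f (c.ι.app j)
             naturality := fun i j u => by simp [G', pullback.lift_fst] } }
  let α : G' ⟶ G :=
    { app := fun j => pullback.snd f (c.ι.app j)
      naturality := fun i j u => by simp [G', pullback.lift_snd] }
  have hp (j : J) : IsPullback (c'.ι.app j) (α.app j) f (c.ι.app j) :=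
    IsPullback.of_hasPullback f (c.ι.app j)
  obtain ⟨hc'⟩ := hc c' α f (by ext j; exact (hp j).w.symm) (fun i j u => by
    refine IsPullback.of_right (h₁₂ := c'.ι.app j) (h₂₂ := c.ι.app j) (v₁₃ := f) ?_
      (α.naturality u) (hp j)
    rw [c'.w, c.w]
    exact hp i) hp
  intro x hx
  have hmem (j : J) : (coconeSieve c).pullback f (c'.ι.app j) := ⟨j, α.app j, (hp j).w.symm⟩
  have hx' := hx.to_sieveCompatible
  let s : Cocone G' :=
    { pt := W
      ι := { app := fun j => x (c'.ι.app j) (hmem j)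
             naturality := fun i j u => by
              refine ((hx' (c'.ι.app j) (G'.map u) (hmem j)).symm.trans ?_).trans
                (Category.comp_id _).symm
              congr 1
              exact c'.w u } }
  refine ⟨hc'.desc s, ?_, fun t ht => hc'.hom_ext fun j => ?_⟩
  · rintro Z g ⟨j, h, hg⟩
    have h₁ : (hp j).lift g h hg.symm ≫ c'.ι.app j = g := (hp j).lift_fst _ _ _
    change g ≫ hc'.desc s = x g _
    have h₂ : x g ⟨j, h, hg⟩ = (hp j).lift g h hg.symm ≫ x (c'.ι.app j) (hmem j) := by
      refine Eq.trans ?_ (hx' (c'.ι.app j) ((hp j).lift g h hg.symm) (hmem j))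
      congr 1
      exact h₁.symm
    rw [h₂]
    conv_lhs => rw [← h₁]
    rw [Category.assoc, hc'.fac]
  · rw [hc'.fac]
    exact ht _ (hmem j)

end CanonicalCovers

/-! ### Summand inclusions are monic and disjoint -/

section DisjointCoproducts

variable {E : Type u} [Category.{v} E] [HasColimitsOfSize.{v, v} E] [HasFiniteLimits E]

/-- Pulling `X ⨿ Y` back along `coprod.inl` exhibits `X` as `(X ×_{X ⨿ Y} X) ⨿ ∅`. So the first
projection has a retraction, which must be the diagonal, and the two projections coincide. -/
theorem mono_coprod_inl [∀ {X Y : E} (f : X ⟶ Y), PreservesColimitsOfSize.{v, v} (Over.pullback f)]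
    {X Y : E} (h : IsPullback (initial.to X) (initial.to Y) (coprod.inl : X ⟶ X ⨿ Y) coprod.inr) :
    Mono (coprod.inl : X ⟶ X ⨿ Y) := by
  have hu : IsUniversalColimit (BinaryCofan.mk (coprod.inl : X ⟶ X ⨿ Y) coprod.inr) :=
    isUniversalColimit_of_preservesColimitsOfShape
      (fun f => (preservesColimitsOfSize_shrink.{0, v, 0, v} _).preservesColimitsOfShape)
      (coprodIsCoprod X Y)
  have hp := IsPullback.of_hasPullback (coprod.inl : X ⟶ X ⨿ Y) coprod.inl
  obtain ⟨hc⟩ := hu (BinaryCofan.mk (pullback.fst coprod.inl coprod.inl) (initial.to X))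
    (mapPair (pullback.snd coprod.inl coprod.inl) (initial.to Y)) coprod.inl
    (by
      ext ⟨_ | _⟩
      · exact hp.w.symm
      · exact h.w.symm)
    (NatTrans.Equifibered.of_discrete _)
    (by
      rintro ⟨_ | _⟩
      · exact hp
      · exact h)
  obtain ⟨d, hd⟩ : ∃ d : X ⟶ pullback (coprod.inl : X ⟶ X ⨿ Y) coprod.inl,
      pullback.fst _ _ ≫ d = 𝟙 _ :=
    ⟨_, (BinaryCofan.IsColimit.desc' hc (𝟙 _) (initial.to _)).2.1⟩
  generalize pullback.fst (coprod.inl : X ⟶ X ⨿ Y) coprod.inl = fst at hp hd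
  generalize pullback.snd (coprod.inl : X ⟶ X ⨿ Y) coprod.inl = snd at hp
  have h₁ : d = hp.lift (𝟙 X) (𝟙 X) rfl := by
    have := hp.lift (𝟙 X) (𝟙 X) rfl ≫= hd
    rwa [← Category.assoc, hp.lift_fst, Category.id_comp, Category.comp_id] at this
  have h₂ : snd = fst := by
    rw [← Category.comp_id fst, ← hp.lift_snd (𝟙 X) (𝟙 X) rfl, ← h₁, reassoc_of% hd]
  refine ⟨fun a b hab => ?_⟩
  exact (hp.lift_fst a b hab).symm.trans
    ((congrArg _ h₂.symm).trans (hp.lift_snd a b hab))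

theorem GiraudAxioms.mono_sigma_ι (h : GiraudAxioms E) {ι : Type v} (X : ι → E) (i : ι) :
    Mono (Sigma.ι X i) := by
  classical
  have := h.pullbackPreservesColimits
  have := mono_coprod_inl (h.disjointCoproducts (X i) (∐ X))
  -- Sending the summand `i` left and all others right reduces the claim to binary coproducts.
  let m : ∐ X ⟶ X i ⨿ ∐ X := Sigma.desc fun j =>
    if e : j = i then eqToHom (by rw [e]) ≫ coprod.inl else Sigma.ι X j ≫ coprod.inr
  have : Sigma.ι X i ≫ m = coprod.inl := by simp [m]
  exact mono_of_mono_fac this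

theorem GiraudAxioms.exists_hom_initial (h : GiraudAxioms E) {ι : Type v} (X : ι → E) {i j : ι}
    (hij : i ≠ j) {W : E} {p : W ⟶ X i} {q : W ⟶ X j} (w : p ≫ Sigma.ι X i = q ≫ Sigma.ι X j) :
    Nonempty (W ⟶ ⊥_ E) := by
  classical
  let m : ∐ X ⟶ X i ⨿ ∐ X := Sigma.desc fun j =>
    if e : j = i then eqToHom (by rw [e]) ≫ coprod.inl else Sigma.ι X j ≫ coprod.inr
  have h₁ : Sigma.ι X i ≫ m = coprod.inl := by simp [m]
  have h₂ : Sigma.ι X j ≫ m = Sigma.ι X j ≫ coprod.inr := by simp [m, hij.symm]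
  refine ⟨(h.disjointCoproducts (X i) (∐ X)).lift p (q ≫ Sigma.ι X j) ?_⟩
  rw [← h₁, reassoc_of% w, h₂, Category.assoc]

end DisjointCoproducts

/-! ### The site on a small dense subcategory -/

section DenseSite

open Opposite

theorem coconeSieve_mem {E : Type u} [Category.{v} E] [HasPullbacks E] {J : Type*} [Category* J] [HasColimitsOfShape J E]
    [∀ {X Y : E} (f : X ⟶ Y), PreservesColimitsOfShape J (Over.pullback f)] {G : J ⥤ E}
    {c : Cocone G} (hc : IsColimit c) : coconeSieve c ∈ Sheaf.canonicalTopology E c.pt :=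
  coconeSieve_mem_canonicalTopology
    (isUniversalColimit_of_preservesColimitsOfShape (fun _ => inferInstance) hc)

section

variable {E : Type u} [Category.{v} E] {C : Type v} [SmallCategory C] (F : C ⥤ E)

/-- The topology on a small category induced by the canonical topology along a functor. -/
abbrev denseTopology : GrothendieckTopology C :=
  F.inducedTopology (Sheaf.canonicalTopology E)

/-- The presheaf on a small category represented by an object along a functor. -/
abbrev restrictedYoneda : E ⥤ Cᵒᵖ ⥤ Type v :=
  yoneda ⋙ (Functor.whiskeringLeft Cᵒᵖ Eᵒᵖ (Type v)).obj F.op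

theorem isSheaf_restrictedYoneda (X : E) :
    Presieve.IsSheaf (denseTopology F) ((restrictedYoneda F).obj X) :=
  F.op_comp_isSheaf_of_types _ (Sheaf.canonicalTopology E)
    ⟨yoneda.obj X, (isSheaf_iff_isSheaf_of_type _ _).2 (Sheaf.isSheaf_yoneda_obj X)⟩

variable {F} in
theorem hom_ext_of_mem_denseTopology {Z : C} {X : E} {T : Sieve Z} (hT : T ∈ denseTopology F Z)
    {a b : F.obj Z ⟶ X} (h : ∀ ⦃W : C⦄ (g : W ⟶ Z), T g → F.map g ≫ a = F.map g ≫ b) : a = b :=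
  (isSheaf_restrictedYoneda F X T hT).isSeparatedFor.ext (fun _ g hg => h g hg)

variable [F.IsDense]

theorem hom_ext_of_isDense {X Y : E} {a b : X ⟶ Y}
    (h : ∀ ⦃Z : C⦄ (z : F.obj Z ⟶ X), z ≫ a = z ≫ b) : a = b :=
  (F.denseAt X).hom_ext' fun _ z =>
    (Category.id_comp _).trans ((h z).trans (Category.id_comp _).symm)

/-- Up to universe lifting, `restrictedYoneda` is the restricted Yoneda functor of Mathlib. -/
def restrictedULiftYonedaIso : Presheaf.restrictedULiftYoneda.{v} F ≅ restrictedYoneda F :=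
  Functor.isoWhiskerRight (uliftYonedaIsoYoneda.{v, v, u} (C := E))
    ((Functor.whiskeringLeft Cᵒᵖ Eᵒᵖ (Type v)).obj F.op)

instance : (restrictedYoneda F).Faithful :=
  Functor.Faithful.of_iso (restrictedULiftYonedaIso F)

instance : (restrictedYoneda F).Full :=
  Functor.Full.of_iso (restrictedULiftYonedaIso F)

end

variable {E : Type u} [Category.{v} E] [HasColimitsOfSize.{v, v} E] [HasFiniteLimits E]
  [∀ {X Y : E} (f : X ⟶ Y), PreservesColimitsOfSize.{v, v} (Over.pullback f)]
  {C : Type v} [SmallCategory C] (F : C ⥤ E)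

instance isCoverDense_canonicalTopology [F.IsDense] :
    F.IsCoverDense (Sheaf.canonicalTopology E) where
  is_cover X := by
    refine GrothendieckTopology.superset_covering _ ?_ (coconeSieve_mem (F.denseAt X))
    rintro Y f ⟨j, h, rfl⟩
    exact ⟨⟨_, h, j.hom, congrArg _ (Category.id_comp _).symm⟩⟩

variable [F.Full] [F.Faithful] [F.IsDense]

variable {F}

theorem functorPullback_mem_denseTopology {Z : C} {T : Sieve (F.obj Z)}
    (hT : T ∈ Sheaf.canonicalTopology E (F.obj Z)) : T.functorPullback F ∈ denseTopology F Z :=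
  (F.mem_inducedTopology_iff_of_isCoverDense _ _).2
    (Functor.IsCoverDense.functorPullback_pushforward_covering ⟨T, hT⟩)

/-- The arrows of the dense subcategory along which an arrow lifts to a leg of a cocone. -/
theorem exists_local_lift {J : Type*} [Category* J] [HasColimitsOfShape J E]
    [∀ {X Y : E} (f : X ⟶ Y), PreservesColimitsOfShape J (Over.pullback f)] {G : J ⥤ E}
    {c : Cocone G} (hc : IsColimit c) {Z : C} (q : F.obj Z ⟶ c.pt) :
    ∃ T ∈ denseTopology F Z, ∀ ⦃W : C⦄ (g : W ⟶ Z), T g →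
      ∃ (j : J) (h : F.obj W ⟶ G.obj j), h ≫ c.ι.app j = F.map g ≫ q :=
  ⟨_, functorPullback_mem_denseTopology
    (GrothendieckTopology.pullback_stable _ q (coconeSieve_mem hc)), fun _ _ hg => hg⟩

/-- The initial object is an empty colimit, so a cover on which maps to it lift to a leg has no
arrows. -/
theorem bot_mem_denseTopology {Z : C} (z : F.obj Z ⟶ ⊥_ E) : ⊥ ∈ denseTopology F Z := by
  obtain ⟨T, hT, h⟩ := exists_local_lift (F := F) (colimit.isColimit (Discrete.functor PEmpty.elim : Discrete PEmpty.{v + 1} ⥤ E))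
    (z ≫ initial.to _)
  refine GrothendieckTopology.superset_covering _ ?_ hT
  intro W g hg
  obtain ⟨⟨⟨⟩⟩, -⟩ := h g hg

end DenseSite

/-! ### Subsheaves of representable sheaves -/

section Representability

open Opposite

variable {E : Type u} [Category.{v} E] [HasColimitsOfSize.{v, v} E] [HasFiniteLimits E]
  [∀ {X Y : E} (f : X ⟶ Y), PreservesColimitsOfSize.{v, v} (Over.pullback f)]
  {C : Type v} [SmallCategory C] (F : C ⥤ E) [F.Full] [F.Faithful] [F.IsDense]

/-- A subsheaf of the sheaf represented by `B` is represented by a subobject of `B`. -/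
theorem exists_mono_of_subsheaf {B : E} (S : ∀ ⦃Z : C⦄, (F.obj Z ⟶ B) → Prop)
    (stable : ∀ ⦃W Z : C⦄ (g : W ⟶ Z) (s : F.obj Z ⟶ B), S s → S (F.map g ≫ s))
    (local_mem : ∀ ⦃Z : C⦄ (s : F.obj Z ⟶ B) (T : Sieve Z), T ∈ denseTopology F Z →
      (∀ ⦃W : C⦄ (g : W ⟶ Z), T g → S (F.map g ≫ s)) → S s) :
    ∃ (R : E) (m : R ⟶ B), Mono m ∧
      ∀ ⦃X : E⦄ (f : X ⟶ B), (∃ t : X ⟶ R, t ≫ m = f) ↔ ∀ ⦃Z : C⦄ (z : F.obj Z ⟶ X), S (z ≫ f) := by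
  let Q : ObjectProperty (CostructuredArrow F B) := fun o => S o.hom
  let G : Q.FullSubcategory ⥤ E := Q.ι ⋙ CostructuredArrow.proj F B ⋙ F
  let m : colimit G ⟶ B := colimit.desc G
    { pt := B
      ι := { app := fun o => o.obj.hom
             naturality := fun o o' u => (CostructuredArrow.w u.hom).trans (Category.comp_id _).symm } }
  have hm (o : Q.FullSubcategory) : colimit.ι G o ≫ m = o.obj.hom := colimit.ι_desc _ _
  let mk {Z : C} (s : F.obj Z ⟶ B) (hs : S s) : Q.FullSubcategory := ⟨CostructuredArrow.mk s, hs⟩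
  -- A map into a leg of the colimit is determined by its composite to `B`. Since maps to the
  -- colimit lift locally to legs, this makes `m` monic.
  have hι {W : C} (o : Q.FullSubcategory) (h : F.obj W ⟶ G.obj o) (s : F.obj W ⟶ B) (hs : S s)
      (e : h ≫ o.obj.hom = s) : h ≫ colimit.ι G o = colimit.ι G (mk s hs) := by
    let φ : mk s hs ⟶ o := ObjectProperty.homMk (CostructuredArrow.homMk (F.preimage h)
      ((congrArg (· ≫ o.obj.hom) (F.map_preimage h)).trans e))
    rw [← colimit.w G φ]
    congr 1
    exact (F.map_preimage h).symm
  have hS {W : C} (o : Q.FullSubcategory) (h : F.obj W ⟶ G.obj o) : S (h ≫ o.obj.hom) := by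
    have := stable (F.preimage h) o.obj.hom o.property
    rwa [F.map_preimage] at this
  have mono_m : Mono m := ⟨fun {X} a b hab => hom_ext_of_isDense F fun Z z => by
    obtain ⟨T, hT, hT'⟩ := exists_local_lift (F := F) (colimit.isColimit G) (z ≫ a)
    obtain ⟨T₁, hT₁, hT₁'⟩ := exists_local_lift (F := F) (colimit.isColimit G) (z ≫ b)
    refine hom_ext_of_mem_denseTopology (GrothendieckTopology.intersection_covering _ hT hT₁) ?_
    rintro W g ⟨hg, hg₁⟩
    obtain ⟨o, h, e⟩ := hT' g hg
    obtain ⟨o₁, h₁, e₁⟩ := hT₁' g hg₁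
    have key : h₁ ≫ o₁.obj.hom = h ≫ o.obj.hom := by
      rw [← hm, ← hm]
      have := e =≫ m
      have := e₁ =≫ m
      simp only [Category.assoc, colimit.cocone_ι] at *
      rw [‹h ≫ _ = _›, ‹h₁ ≫ _ = _›, hab]
    rw [← e, ← e₁]
    exact (hι o h _ (hS o h) rfl).trans (hι o₁ h₁ _ (hS o h) key).symm⟩
  refine ⟨colimit G, m, mono_m, fun X f => ⟨?_, fun hf => ?_⟩⟩
  · rintro ⟨t, rfl⟩ Z z
    obtain ⟨T, hT, hT'⟩ := exists_local_lift (F := F) (colimit.isColimit G) (z ≫ t)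
    refine local_mem _ T hT fun W g hg => ?_
    obtain ⟨o, h, e⟩ := hT' g hg
    have := e =≫ m
    simp only [Category.assoc, colimit.cocone_ι, hm] at this
    rw [← this]
    exact hS o h
  · let c : Cocone (CostructuredArrow.proj F X ⋙ F) :=
      { pt := colimit G
        ι := { app := fun o => colimit.ι G (mk (o.hom ≫ f) (hf o.hom))
               naturality := fun o o' u => by
                rw [← cancel_mono m]
                refine (Category.assoc _ _ _).trans ((congrArg _ (hm _)).trans ?_)
                refine Eq.trans ?_ ((congrArg (· ≫ m) (Category.comp_id
                  (colimit.ι G (mk (o.hom ≫ f) (hf o.hom))))).trans (hm _)).symm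
                exact (Category.assoc _ _ _).symm.trans
                  (congrArg (· ≫ f) (CostructuredArrow.w u)) } }
    obtain ⟨d, hd⟩ : ∃ d : X ⟶ colimit G, ∀ ⦃Z : C⦄ (z : F.obj Z ⟶ X),
        z ≫ d = colimit.ι G (mk (z ≫ f) (hf z)) :=
      ⟨(F.denseAt X).desc c, fun Z z => (congrArg (· ≫ _) (Category.id_comp z).symm).trans
        ((F.denseAt X).fac c (CostructuredArrow.mk z))⟩
    refine ⟨d, hom_ext_of_isDense F fun Z z => ?_⟩
    rw [reassoc_of% hd]
    exact hm _

end Representability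

/-! ### Every sheaf is represented by a quotient of a coproduct -/

section EssentialSurjectivity

open Opposite

variable {E : Type u} [Category.{v} E] [HasColimitsOfSize.{v, v} E]
  {C : Type v} [SmallCategory C] (F : C ⥤ E) (P : Cᵒᵖ ⥤ Type v)

/-- The coproduct, indexed by the elements of a presheaf, of the objects they live on. -/
noncomputable abbrev elementsCoproduct : E :=
  ∐ fun x : Σ U : C, P.obj (op U) => F.obj x.1

variable {P} in
/-- The inclusion of the summand of an element into `elementsCoproduct`. -/
noncomputable abbrev elementι {U : C} (a : P.obj (op U)) : F.obj U ⟶ elementsCoproduct F P :=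
  Sigma.ι (fun x : Σ U : C, P.obj (op U) => F.obj x.1) ⟨U, a⟩

/-- Two sections of `elementsCoproduct` are related if they induce the same sections of the
presheaf wherever they both factor through a summand. -/
def ElementsRel ⦃Z : C⦄ (x y : F.obj Z ⟶ elementsCoproduct F P) : Prop :=
  ∀ ⦃W U V : C⦄ (g : W ⟶ Z) (p : W ⟶ U) (q : W ⟶ V) (a : P.obj (op U)) (b : P.obj (op V)),
    F.map g ≫ x = F.map p ≫ elementι F a → F.map g ≫ y = F.map q ≫ elementι F b →
      P.map p.op a = P.map q.op b

variable {F P}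

theorem ElementsRel.symm {Z : C} {x y : F.obj Z ⟶ elementsCoproduct F P}
    (h : ElementsRel F P x y) : ElementsRel F P y x :=
  fun _ _ _ g p q a b hp hq => (h g q p b a hq hp).symm

theorem ElementsRel.map {Z Z' : C} (g : Z' ⟶ Z) {x y : F.obj Z ⟶ elementsCoproduct F P}
    (h : ElementsRel F P x y) : ElementsRel F P (F.map g ≫ x) (F.map g ≫ y) :=
  fun _ _ _ g' p q a b hp hq => h (g' ≫ g) p q a b (by simpa using hp) (by simpa using hq)

theorem ElementsRel.eq {U : C} {a b : P.obj (op U)}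
    (h : ElementsRel F P (elementι F a) (elementι F b)) : a = b := by
  simpa using h (𝟙 U) (𝟙 U) (𝟙 U) a b rfl rfl

theorem ElementsRel.of_local (hP : Presieve.IsSheaf (denseTopology F) P) {Z : C}
    {x y : F.obj Z ⟶ elementsCoproduct F P} {T : Sieve Z} (hT : T ∈ denseTopology F Z)
    (h : ∀ ⦃W : C⦄ (g : W ⟶ Z), T g → ElementsRel F P (F.map g ≫ x) (F.map g ≫ y)) :
    ElementsRel F P x y := by
  intro W U V g p q a b hp hq
  refine (hP _ (GrothendieckTopology.pullback_stable _ g hT)).isSeparatedFor.ext ?_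
  intro W' g' hg'
  have := h (g' ≫ g) hg' (𝟙 _) (g' ≫ p) (g' ≫ q) a b (by simp [hp]) (by simp [hq])
  simpa using this

variable [HasFiniteLimits E] [F.Full] [F.Faithful] [F.IsDense]

/-- Within one summand the inclusion is monic, so `p = q`. Across distinct summands `F.obj W` maps
to `∅`, so the empty sieve covers `W` and all sections of `P` over it agree. -/
theorem map_eq_of_elementι_eq (hE : GiraudAxioms E) (hP : Presieve.IsSheaf (denseTopology F) P)
    {W U V : C} {p : W ⟶ U} {q : W ⟶ V} {a : P.obj (op U)} {b : P.obj (op V)}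
    (h : F.map p ≫ elementι F a = F.map q ≫ elementι F b) : P.map p.op a = P.map q.op b := by
  have := hE.pullbackPreservesColimits
  by_cases hab : (⟨U, a⟩ : Σ U : C, P.obj (op U)) = ⟨V, b⟩
  · obtain rfl : U = V := congrArg Sigma.fst hab
    obtain rfl : a = b := eq_of_heq (Sigma.mk.inj hab).2
    have := hE.mono_sigma_ι (fun x : Σ U : C, P.obj (op U) => F.obj x.1) ⟨U, a⟩
    rw [F.map_injective ((cancel_mono _).1 h)]
  · obtain ⟨z⟩ := hE.exists_hom_initial (fun x : Σ U : C, P.obj (op U) => F.obj x.1) hab h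
    exact (hP _ (bot_mem_denseTopology z)).isSeparatedFor.ext (fun _ _ hg => hg.elim)

theorem ElementsRel.refl (hE : GiraudAxioms E) (hP : Presieve.IsSheaf (denseTopology F) P)
    {Z : C} (x : F.obj Z ⟶ elementsCoproduct F P) : ElementsRel F P x x :=
  fun _ _ _ _ _ _ _ _ hp hq => map_eq_of_elementι_eq hE hP (hp.symm.trans hq)

theorem ElementsRel.of_map (hE : GiraudAxioms E) (hP : Presieve.IsSheaf (denseTopology F) P)
    {W U : C} (p : W ⟶ U) (a : P.obj (op U)) :
    ElementsRel F P (elementι F (P.map p.op a)) (F.map p ≫ elementι F a) := by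
  intro W' U' V g p' q a' b hp hq
  rw [← map_eq_of_elementι_eq hE hP hp]
  have := map_eq_of_elementι_eq hE hP (p := g ≫ p) (a := a) (by simpa using hq)
  simpa using this

theorem exists_local_elementι (hE : GiraudAxioms E) {Z : C}
    (x : F.obj Z ⟶ elementsCoproduct F P) :
    ∃ T ∈ denseTopology F Z, ∀ ⦃W : C⦄ (g : W ⟶ Z), T g →
      ∃ (U : C) (p : W ⟶ U) (a : P.obj (op U)), F.map g ≫ x = F.map p ≫ elementι F a := by
  have := hE.pullbackPreservesColimits
  obtain ⟨T, hT, h⟩ := exists_local_lift (F := F)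
    (colimit.isColimit (Discrete.functor fun x : Σ U : C, P.obj (op U) => F.obj x.1)) x
  refine ⟨T, hT, fun W g hg => ?_⟩
  obtain ⟨⟨⟨U, a⟩⟩, p, e⟩ := h g hg
  exact ⟨U, F.preimage p, a, e.symm.trans (congrArg (· ≫ _) (F.map_preimage p).symm)⟩

/-- The middle section factors through a summand only locally, so the equality is checked on a
cover, where `P` is separated. -/
theorem ElementsRel.trans (hE : GiraudAxioms E) (hP : Presieve.IsSheaf (denseTopology F) P)
    {Z : C} {x y z : F.obj Z ⟶ elementsCoproduct F P} (h : ElementsRel F P x y)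
    (h' : ElementsRel F P y z) : ElementsRel F P x z := by
  obtain ⟨T, hT, hy⟩ := exists_local_elementι hE y
  intro W U V g p q a b hp hq
  refine (hP _ (GrothendieckTopology.pullback_stable _ g hT)).isSeparatedFor.ext ?_
  intro W' g' hg'
  obtain ⟨U', r, c, hr⟩ := hy (g' ≫ g) hg'
  have h₁ := h (g' ≫ g) (g' ≫ p) r a c (by simp [hp]) hr
  have h₂ := h' (g' ≫ g) r (g' ≫ q) c b hr (by simp [hq])
  simpa using h₁.trans h₂

/-- The relation `ElementsRel` is the kernel pair of a regular epimorphism. -/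
theorem exists_elements_quotient (hE : GiraudAxioms E)
    (hP : Presieve.IsSheaf (denseTopology F) P) :
    ∃ (R : E) (p₁ p₂ : R ⟶ elementsCoproduct F P), ∀ ⦃Z : C⦄
      (x y : F.obj Z ⟶ elementsCoproduct F P), x ≫ coequalizer.π p₁ p₂ = y ≫ coequalizer.π p₁ p₂ ↔
        ElementsRel F P x y := by
  have := hE.pullbackPreservesColimits
  obtain ⟨R, m, _, hm⟩ := exists_mono_of_subsheaf F
    (B := elementsCoproduct F P ⨯ elementsCoproduct F P)
    (fun Z s => ElementsRel F P (s ≫ prod.fst) (s ≫ prod.snd))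
    (fun W Z g s hs => by simpa using hs.map g)
    (fun Z s T hT h => ElementsRel.of_local hP hT (fun W g hg => by simpa using h g hg))
  -- `R` classifies related pairs of generalized elements; the structure maps of the equivalence
  -- relation all come from this.
  have hfac {X : E} (a b : X ⟶ elementsCoproduct F P) :
      (∃ t : X ⟶ R, t ≫ m ≫ prod.fst = a ∧ t ≫ m ≫ prod.snd = b) ↔
        ∀ ⦃Z : C⦄ (z : F.obj Z ⟶ X), ElementsRel F P (z ≫ a) (z ≫ b) := by
    have := hm (prod.lift a b)
    simp only [Category.assoc, prod.lift_fst, prod.lift_snd] at this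
    rw [← this]
    refine exists_congr fun t => ⟨fun h => ?_, fun h => ?_⟩
    · apply Limits.prod.hom_ext <;> simp [h, prod.lift_fst, prod.lift_snd]
    · rw [reassoc_of% h, reassoc_of% h, prod.lift_fst, prod.lift_snd]
      exact ⟨rfl, rfl⟩
  have hR ⦃Z : C⦄ (z : F.obj Z ⟶ R) :
      ElementsRel F P (z ≫ m ≫ prod.fst) (z ≫ m ≫ prod.snd) :=
    (hfac _ _).1 ⟨𝟙 R, by simp⟩ z
  obtain ⟨r, hr₁, hr₂⟩ := (hfac (𝟙 _) (𝟙 _)).2 fun Z z => ElementsRel.refl hE hP _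
  obtain ⟨s, hs₁, hs₂⟩ := (hfac (m ≫ prod.snd) (m ≫ prod.fst)).2 fun Z z => (hR z).symm
  let c := pullback.cone (m ≫ prod.snd) (m ≫ prod.fst)
  obtain ⟨t, ht₁, ht₂⟩ := (hfac (c.fst ≫ m ≫ prod.fst) (c.snd ≫ m ≫ prod.snd)).2 fun Z z => by
    have h₁ := hR (z ≫ c.fst)
    have h₂ := hR (z ≫ c.snd)
    simp only [Category.assoc] at h₁ h₂ ⊢
    rw [c.condition] at h₁
    exact h₁.trans hE hP h₂
  let e : EquivalenceRelation (m ≫ prod.fst) (m ≫ prod.snd) :=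
    { right_cancellation := fun Y f g h₁ h₂ => by
        rw [← cancel_mono m]
        apply Limits.prod.hom_ext <;> simpa
      r := r
      reflexivity₁ := hr₁
      reflexivity₂ := hr₂
      s := s
      symmetry₁ := hs₁
      symmetry₂ := hs₂
      c := c
      isLimit := pullback.isLimit _ _
      t := t
      transitivity₁ := ht₁
      transitivity₂ := ht₂ }
  have hk := hE.effectiveEquivalenceRelations _ _ e.isEquivalenceRelation
  refine ⟨R, m ≫ prod.fst, m ≫ prod.snd, fun Z x y => ⟨fun h => ?_, fun h => ?_⟩⟩
  · have := (hfac x y).1 ⟨hk.lift x y h, hk.lift_fst _ _ _, hk.lift_snd _ _ _⟩ (𝟙 _)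
    simpa using this
  · obtain ⟨t, rfl, rfl⟩ := (hfac x y).2 fun W z => by
      have := h.map (F.preimage z)
      rwa [F.map_preimage] at this
    simpa using t ≫= coequalizer.condition (m ≫ prod.fst) (m ≫ prod.snd)

/-- Every sheaf for the topology induced on a dense small full subcategory is represented by an
object of the ambient category. -/
theorem exists_iso_restrictedYoneda (hE : GiraudAxioms E)
    (hP : Presieve.IsSheaf (denseTopology F) P) :
    ∃ Q : E, Nonempty (P ≅ (restrictedYoneda F).obj Q) := by
  have := hE.pullbackPreservesColimits
  obtain ⟨R, p₁, p₂, h⟩ := exists_elements_quotient hE hP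
  let θ : P ⟶ (restrictedYoneda F).obj (coequalizer p₁ p₂) :=
    { app := fun U => ↾fun a => elementι F a ≫ coequalizer.π p₁ p₂
      naturality := fun U V g => by
        ext a
        refine ((h _ _).2 (ElementsRel.of_map hE hP g.unop a)).trans ?_
        exact Category.assoc _ _ _ }
  have inj {U : C} {a b : P.obj (op U)}
      (hab : elementι F a ≫ coequalizer.π p₁ p₂ = elementι F b ≫ coequalizer.π p₁ p₂) : a = b :=
    ((h _ _).1 hab).eq
  have nat {W U : C} (p : W ⟶ U) (a : P.obj (op U)) :
      elementι F (P.map p.op a) ≫ coequalizer.π p₁ p₂ =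
        F.map p ≫ elementι F a ≫ coequalizer.π p₁ p₂ :=
    ((h _ _).2 (ElementsRel.of_map hE hP p a)).trans (Category.assoc _ _ _)
  -- Locally `q` lifts through the quotient map and then to a summand, so it comes from elements of
  -- `P`; injectivity makes these match, and they glue.
  have surj {Z : C} (q : F.obj Z ⟶ coequalizer p₁ p₂) :
      ∃ a : P.obj (op Z), elementι F a ≫ coequalizer.π p₁ p₂ = q := by
    let T : Sieve Z :=
      { arrows := fun W g => ∃ a : P.obj (op W), elementι F a ≫ coequalizer.π p₁ p₂ = F.map g ≫ q
        downward_closed := by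
          rintro W W' g ⟨a, ha⟩ g'
          exact ⟨P.map g'.op a, by rw [nat, ha, F.map_comp, Category.assoc]⟩ }
    have hT : T ∈ denseTopology F Z := by
      have (X Y : E) (f : X ⟶ Y) : PreservesColimitsOfShape WalkingParallelPair (Over.pullback f) :=
        (preservesColimitsOfSize_shrink.{0, v, 0, v} _).preservesColimitsOfShape
      obtain ⟨T₁, hT₁, h₁⟩ := exists_local_lift (F := F)
        (coequalizerIsCoequalizer p₁ p₂) q
      refine GrothendieckTopology.transitive _ hT₁ T fun W g hg => ?_
      obtain ⟨x, hx⟩ : ∃ x : F.obj W ⟶ elementsCoproduct F P,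
          x ≫ coequalizer.π p₁ p₂ = F.map g ≫ q := by
        -- The lift may land in `R`, whose leg is `p₁` followed by the quotient map.
        obtain ⟨⟨⟩, x, hx⟩ := h₁ g hg
        · exact ⟨x ≫ p₁, by simpa using hx⟩
        · exact ⟨x, by simpa using hx⟩
      obtain ⟨T₂, hT₂, h₂⟩ := exists_local_elementι hE x
      refine GrothendieckTopology.superset_covering _ (fun W' g' hg' => ?_) hT₂
      obtain ⟨U, p, a, e⟩ := h₂ g' hg'
      exact ⟨P.map p.op a, by rw [nat, ← reassoc_of% e, hx, F.map_comp, Category.assoc]⟩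
    choose x hx using fun (W : C) (g : W ⟶ Z) (hg : T g) => hg
    obtain ⟨a, ha, -⟩ := hP T hT (fun W g hg => x W g hg) (by
      intro W₁ W₂ W g₁ g₂ f₁ f₂ h₁ h₂ e
      apply inj
      rw [nat, nat, hx, hx, ← F.map_comp_assoc, e, F.map_comp_assoc])
    refine ⟨a, hom_ext_of_mem_denseTopology hT fun W g hg => ?_⟩
    rw [← nat, ← hx W g hg]
    congr 2
    exact ha g hg
  have (U : Cᵒᵖ) : IsIso (θ.app U) := (isIso_iff_bijective _).2 ⟨fun _ _ => inj, surj⟩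
  have := NatIso.isIso_of_isIso_app θ
  exact ⟨_, ⟨asIso θ⟩⟩

end EssentialSurjectivity

/-! ### Giraud's axioms imply being a topos -/

section GiraudToTopos

variable (E : Type u) [Category.{v} E] [IsLocallyPresentable.{v} E]

theorem exists_dense_functor :
    ∃ (C : Type v) (_ : SmallCategory C) (F : C ⥤ E), F.Full ∧ F.Faithful ∧ F.IsDense := by
  obtain ⟨κ, _, _⟩ := IsLocallyPresentable.exists_cardinal.{v} E
  have : EssentiallySmall.{v} (isCardinalPresentable E κ).FullSubcategory := inferInstance
  exact ⟨SmallModel.{v} (isCardinalPresentable E κ).FullSubcategory, inferInstance,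
    (equivSmallModel.{v} _).inverse ⋙ (isCardinalPresentable E κ).ι, inferInstance, inferInstance,
    inferInstance⟩

theorem isCoverageSheaf_toCoverage_iff {C : Type v} [SmallCategory C] (J : GrothendieckTopology C)
    (P : Cᵒᵖ ⥤ Type v) : IsCoverageSheaf J.toCoverage P ↔ Presieve.IsSheaf J P := by
  have := Presieve.isSheaf_coverage J.toCoverage P
  rw [(Coverage.gi C).l_u_eq] at this
  exact this.symm

variable {E}

theorem GiraudAxioms.isGrothendieckTopos (h : GiraudAxioms E) : IsGrothendieckTopos E := by
  obtain ⟨C, _, F, _, _, _⟩ := exists_dense_functor E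
  refine ⟨C, inferInstance, (denseTopology F).toCoverage, fun U => ?_, ?_⟩
  · rw [GrothendieckTopology.mem_toCoverage_iff]
    refine GrothendieckTopology.superset_covering _ ?_ (GrothendieckTopology.top_mem _ U)
    intro V f _
    exact ⟨U, f, 𝟙 U, ⟨⟩, Category.comp_id f⟩
  · let N : E ⥤ (IsCoverageSheaf (denseTopology F).toCoverage).FullSubcategory :=
      ObjectProperty.lift _ (restrictedYoneda F) fun X =>
        (isCoverageSheaf_toCoverage_iff _ _).2 (isSheaf_restrictedYoneda F X)
    have : N.EssSurj := ⟨fun P => by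
      obtain ⟨Q, ⟨e⟩⟩ := exists_iso_restrictedYoneda h
        ((isCoverageSheaf_toCoverage_iff _ _).1 P.property)
      exact ⟨Q, ⟨(ObjectProperty.isoMk _ e).symm⟩⟩⟩
    have : N.Full := inferInstance
    have : N.Faithful := inferInstance
    have : N.IsEquivalence := { }
    exact ⟨N.asEquivalence⟩

end GiraudToTopos

/-! ### Descent in the category of sets -/

section Types

theorem isUniversalColimit_type {J : Type*} [Category* J] {F : J ⥤ Type v} {c : Cocone F}
    (hc : IsColimit c) : IsUniversalColimit c := by
  intro F' c' α f w hα hp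
  have hw (j : J) (x : F'.obj j) : f (c'.ι.app j x) = c.ι.app j (α.app j x) :=
    ConcreteCategory.congr_hom (hp j).w x
  have hex (x : c'.pt) : ∃ (j : J) (y : F'.obj j), c'.ι.app j y = x := by
    obtain ⟨j, y, hy⟩ := Types.jointly_surjective _ hc (f x)
    obtain ⟨z, hz, -⟩ := Types.exists_of_isPullback (hp j) x y hy.symm
    exact ⟨j, z, hz⟩
  have key (s : Cocone F') : ∃ d : c'.pt → s.pt, ∀ j y, d (c'.ι.app j y) = s.ι.app j y := by
    -- Over each point of `c.pt`, `g` records the graph of the desired map on the fibre of `f`. It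
    -- is well defined on the colimit because the naturality squares of `α` are pullbacks.
    let g : c.pt ⟶ Set (c'.pt × s.pt) := hc.desc
      { pt := Set (c'.pt × s.pt)
        ι := { app := fun j => ↾fun x =>
                { p | ∃ y : F'.obj j, α.app j y = x ∧ c'.ι.app j y = p.1 ∧ s.ι.app j y = p.2 }
               naturality := fun i j u => by
                ext x
                refine Set.ext fun p => ⟨?_, ?_⟩
                · rintro ⟨y, hy, h₁, h₂⟩
                  obtain ⟨z, rfl, hz⟩ := Types.exists_of_isPullback (hα u) y x hy
                  exact ⟨z, hz, (ConcreteCategory.congr_hom (c'.w u) z).symm.trans h₁,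
                    (ConcreteCategory.congr_hom (s.w u) z).symm.trans h₂⟩
                · rintro ⟨y, rfl, h₁, h₂⟩
                  exact ⟨F'.map u y, ConcreteCategory.congr_hom (α.naturality u) y,
                    (ConcreteCategory.congr_hom (c'.w u) y).trans h₁,
                    (ConcreteCategory.congr_hom (s.w u) y).trans h₂⟩ } }
    have hg (j : J) (x : F.obj j) (p : c'.pt × s.pt) : p ∈ (g (c.ι.app j x) : Set _) ↔
        ∃ y : F'.obj j, α.app j y = x ∧ c'.ι.app j y = p.1 ∧ s.ι.app j y = p.2 := by
      have := ConcreteCategory.congr_hom (hc.fac _ j : c.ι.app j ≫ g = _) x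
      exact iff_of_eq (congrArg (p ∈ ·) this)
    have hd (x : c'.pt) : ∃ t : s.pt, (x, t) ∈ (g (f x) : Set _) := by
      obtain ⟨j, y, rfl⟩ := hex x
      exact ⟨s.ι.app j y, by rw [hw, hg]; exact ⟨y, rfl, rfl, rfl⟩⟩
    choose d hd using hd
    refine ⟨d, fun j y => ?_⟩
    have := hd (c'.ι.app j y)
    rw [hw, hg] at this
    obtain ⟨z, h₁, h₂, h₃⟩ := this
    exact h₃.symm.trans (congrArg (s.ι.app j) (Types.ext_of_isPullback (hp j) h₂ h₁))
  choose d hd using key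
  exact ⟨{ desc := fun s => ↾(d s)
           fac := fun s j => by
            ext y
            exact hd s j y
           uniq := fun s m hm => by
            ext x
            obtain ⟨j, y, rfl⟩ := hex x
            exact (ConcreteCategory.congr_hom (hm j) y).trans (hd s j y).symm }⟩

theorem isVanKampenColimit_type_of_discrete {ι : Type v} {F : Discrete ι ⥤ Type v} {c : Cocone F}
    (hc : IsColimit c) : IsVanKampenColimit c := by
  intro F' c' α f w hα
  refine ⟨fun ⟨hc'⟩ j => ?_, isUniversalColimit_type hc c' α f w hα⟩
  have hw (j) (x : F'.obj j) : f (c'.ι.app j x) = c.ι.app j (α.app j x) :=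
    (ConcreteCategory.congr_hom (NatTrans.congr_app w j) x).symm
  -- Mapping the colimit to the disjoint union shows that its legs are injective and have disjoint
  -- images.
  have index {F : Discrete ι ⥤ Type v} {c : Cocone F} (hc : IsColimit c) {i j : Discrete ι}
      {x : F.obj i} {y : F.obj j} (h : c.ι.app i x = c.ι.app j y) :
      (⟨i, x⟩ : Σ k, F.obj k) = ⟨j, y⟩ := by
    let g : c.pt ⟶ (Σ k, F.obj k) := hc.desc
      { pt := Σ k, F.obj k
        ι := Discrete.natTrans fun k => ↾fun z => ⟨k, z⟩ }
    have hg (k) (z : F.obj k) : g (c.ι.app k z) = ⟨k, z⟩ :=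
      ConcreteCategory.congr_hom (hc.fac _ k : c.ι.app k ≫ g = _) z
    rw [← hg, ← hg, h]
  rw [Types.isPullback_iff]
  refine ⟨(NatTrans.congr_app w j).symm, fun x y h => ?_, fun x y h => ?_⟩
  · exact eq_of_heq (Sigma.mk.inj (index hc' h.1)).2
  · obtain ⟨k, z, rfl⟩ := Types.jointly_surjective _ hc' x
    rw [hw] at h
    have := index hc h
    obtain rfl : k = j := congrArg Sigma.fst this
    exact ⟨z, rfl, eq_of_heq (Sigma.mk.inj this).2⟩

variable {X₀ X₁ X₂ Y₀ Y₁ Y₂ X Y : Type v} {a : X₁ ⟶ X₀} {b : X₁ ⟶ X₂} {c : Y₁ ⟶ Y₀} {d : Y₁ ⟶ Y₂}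
  {f₀ : X₀ ⟶ Y₀} {f₁ : X₁ ⟶ Y₁} {f₂ : X₂ ⟶ Y₂} {i₀ : X₀ ⟶ X} {i₂ : X₂ ⟶ X} {j₀ : Y₀ ⟶ Y}
  {j₂ : Y₂ ⟶ Y} {f : X ⟶ Y}

theorem exists_of_isPushout_of_isPullback (h₀ : IsPullback a f₁ f₀ c) (h₂ : IsPullback b f₁ f₂ d)
    (hX : IsPushout a b i₀ i₂) (hY : IsPushout c d j₀ j₂) (w₀ : i₀ ≫ f = f₀ ≫ j₀)
    (w₂ : i₂ ≫ f = f₂ ≫ j₂) {y : Y₀} {x : X} (h : j₀ y = f x) : ∃ z : X₀, f₀ z = y ∧ i₀ z = x := by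
  have hi (z : X₁) : i₀ (a z) = i₂ (b z) := ConcreteCategory.congr_hom hX.w z
  -- For fixed `x`, liftability of `y` together with `x` is a predicate on `Y₀` and on `Y₂`; the
  -- pullback squares make the two agree on `Y₁`, so it descends to `Y`. It holds at `f x` because
  -- `x` has a representative in `X₀` or `X₂`.
  let φ : Y ⟶ ULift.{v} Prop := hY.desc (↾fun y => ⟨∃ z : X₀, f₀ z = y ∧ i₀ z = x⟩)
    (↾fun y => ⟨∃ z : X₂, f₂ z = y ∧ i₂ z = x⟩) (by
      ext y
      constructor
      · rintro ⟨z, hz, rfl⟩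
        obtain ⟨t, rfl, rfl⟩ := Types.exists_of_isPullback h₀ z y hz
        exact ⟨b t, ConcreteCategory.congr_hom h₂.w t, (hi t).symm⟩
      · rintro ⟨z, hz, rfl⟩
        obtain ⟨t, rfl, rfl⟩ := Types.exists_of_isPullback h₂ z y hz
        exact ⟨a t, ConcreteCategory.congr_hom h₀.w t, hi t⟩)
  have φ₀ (y : Y₀) : (φ (j₀ y)).down = ∃ z : X₀, f₀ z = y ∧ i₀ z = x :=
    congrArg ULift.down (ConcreteCategory.congr_hom (hY.inl_desc _ _ _) y)
  have φ₂ (y : Y₂) : (φ (j₂ y)).down = ∃ z : X₂, f₂ z = y ∧ i₂ z = x :=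
    congrArg ULift.down (ConcreteCategory.congr_hom (hY.inr_desc _ _ _) y)
  rw [← φ₀, h]
  obtain ⟨z, hz⟩ | ⟨z, hz⟩ := Types.eq_or_eq_of_isPushout hX x
  · have : f x = j₀ (f₀ z) := by rw [← hz]; exact ConcreteCategory.congr_hom w₀ z
    rw [this, φ₀]
    exact ⟨z, rfl, hz⟩
  · have : f x = j₂ (f₂ z) := by rw [← hz]; exact ConcreteCategory.congr_hom w₂ z
    rw [this, φ₂]
    exact ⟨z, rfl, hz⟩

end Types

/-! ### Pointwise descent in presheaves -/

section FunctorCategory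

variable {C : Type*} [Category* C]

theorem isUniversalColimit_of_evaluation {D J : Type*} [Category* D] [Category* J]
    [HasColimitsOfShape J D] (F : J ⥤ C ⥤ D) (c : Cocone F)
    (hc : ∀ x : C, IsUniversalColimit (((evaluation C D).obj x).mapCocone c)) [HasPullbacks D] :
    IsUniversalColimit c := by
  intro F' c' α f e hα H
  have := fun x => hc x (((evaluation C D).obj x).mapCocone c') (Functor.whiskerRight α _)
      (((evaluation C D).obj x).map f)
      (by
        ext y
        exact NatTrans.congr_app (NatTrans.congr_app e y) x)
      (hα.whiskerRight _)
  exact ⟨evaluationJointlyReflectsColimits _ fun x =>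
      (this x fun j => (H j).map ((evaluation C D).obj x)).some⟩

theorem isUniversalColimit_functor_type {J : Type v} [SmallCategory J] {F : J ⥤ C ⥤ Type v}
    {c : Cocone F} (hc : IsColimit c) : IsUniversalColimit c :=
  isUniversalColimit_of_evaluation F c fun _ =>
    isUniversalColimit_type (isColimitOfPreserves _ hc)

theorem isVanKampenColimit_functor_type_of_discrete {ι : Type v} {F : Discrete ι ⥤ C ⥤ Type v}
    {c : Cocone F} (hc : IsColimit c) : IsVanKampenColimit c :=
  isVanKampenColimit_of_evaluation F c fun _ =>
    isVanKampenColimit_type_of_discrete (isColimitOfPreserves _ hc)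

end FunctorCategory

/-! ### Descent passes to left exact reflections -/

section Reflective

variable {E : Type u} [Category.{v} E] {C : Type v} [SmallCategory C]
  {L : (C ⥤ Type v) ⥤ E} {G : E ⥤ (C ⥤ Type v)} [G.Full] [G.Faithful]

theorem exists_iso_pushout_of_reflective (adj : L ⊣ G) {X₀ X₁ X₂ : E} (a : X₁ ⟶ X₀) (b : X₁ ⟶ X₂)
    [HasPushout a b] : ∃ e : L.obj (pushout (G.map a) (G.map b)) ≅ pushout a b,
      L.map (pushout.inl _ _) ≫ e.hom = adj.counit.app _ ≫ pushout.inl a b ∧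
      L.map (pushout.inr _ _) ≫ e.hom = adj.counit.app _ ≫ pushout.inr a b := by
  have := adj.leftAdjoint_preservesColimits
  have h := ((IsPushout.of_hasPushout (G.map a) (G.map b)).map L).of_iso
    (asIso (adj.counit.app _)) (asIso (adj.counit.app _)) (asIso (adj.counit.app _)) (Iso.refl _)
    (f' := a) (g' := b)
    (inl' := inv (adj.counit.app _) ≫ L.map (pushout.inl _ _))
    (inr' := inv (adj.counit.app _) ≫ L.map (pushout.inr _ _))
    (adj.counit_naturality a) (adj.counit_naturality b) (by simp) (by simp)
  have h' := IsPushout.of_hasPushout a b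
  refine ⟨h.isoIsPushout _ _ h', ?_, ?_⟩
  · exact (IsIso.inv_comp_eq _).1 ((Category.assoc _ _ _).symm.trans (h.inl_isoIsPushout_hom _ _ h'))
  · exact (IsIso.inv_comp_eq _).1 ((Category.assoc _ _ _).symm.trans (h.inr_isoIsPushout_hom _ _ h'))

variable [PreservesFiniteLimits L]

theorem isUniversalColimit_of_reflective (adj : L ⊣ G) {J : Type v} [SmallCategory J] {F : J ⥤ E} {c : Cocone F}
    (hc : IsColimit c) : IsUniversalColimit c := by
  have h := ((isUniversalColimit_functor_type (colimit.isColimit (F ⋙ G))).map_reflective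
    adj).precompose_isIso (F.rightUnitor.inv ≫ Functor.whiskerLeft F (inv adj.counit) ≫
      (Functor.associator _ _ _).inv)
  exact h.of_iso (h.isColimit.uniqueUpToIso hc)

theorem isVanKampenColimit_of_reflective_of_discrete (adj : L ⊣ G) {ι : Type v} {F : Discrete ι ⥤ E}
    {c : Cocone F} (hc : IsColimit c) : IsVanKampenColimit c := by
  have h := ((isVanKampenColimit_functor_type_of_discrete
    (colimit.isColimit (F ⋙ G))).map_reflective
    adj).precompose_isIso (F.rightUnitor.inv ≫ Functor.whiskerLeft F (inv adj.counit) ≫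
      (Functor.associator _ _ _).inv)
  exact h.of_iso (h.isColimit.uniqueUpToIso hc)

/-- By `hs` the presheaf comparison `k` to the pullback is pointwise surjective, hence a regular
epimorphism. `L` preserves this pullback and coequalizers, so `L.map k` is a regular epimorphism,
and it is isomorphic to `l`. -/
theorem effectiveEpi_of_reflective (adj : L ⊣ G) [HasPullbacks E] {P W X Y Z : E} {p : P ⟶ W} {q : P ⟶ X}
    {w : W ⟶ Y} {f : X ⟶ Y} (hP : IsPullback p q w f) (l : Z ⟶ P) {PX PY : C ⥤ Type v}
    {eX : L.obj PX ≅ X} {eY : L.obj PY ≅ Y} {m : PX ⟶ PY} {u' : G.obj Z ⟶ PX} {w' : G.obj W ⟶ PY}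
    (hm : L.map m ≫ eY.hom = eX.hom ≫ f) (hw : L.map w' ≫ eY.hom = adj.counit.app W ≫ w)
    (hu : L.map u' ≫ eX.hom = adj.counit.app Z ≫ l ≫ q) (h : G.map (l ≫ p) ≫ w' = u' ≫ m)
    (hs : ∀ (c : C) (y : (G.obj W).obj c) (x : PX.obj c), w'.app c y = m.app c x →
      ∃ z, (G.map (l ≫ p)).app c z = y ∧ u'.app c z = x) : EffectiveEpi l := by
  let k : G.obj Z ⟶ pullback w' m := pullback.lift _ _ h
  have hk₁ : k ≫ pullback.fst _ _ = G.map (l ≫ p) := pullback.lift_fst _ _ _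
  have hk₂ : k ≫ pullback.snd _ _ = u' := pullback.lift_snd _ _ _
  have : Epi k := by
    rw [NatTrans.epi_iff_epi_app]
    intro c
    rw [CategoryTheory.epi_iff_surjective]
    intro t
    have hpb := (IsPullback.of_hasPullback w' m).map ((evaluation C (Type v)).obj c)
    obtain ⟨z, h₁, h₂⟩ := hs c _ _ (ConcreteCategory.congr_hom hpb.w t)
    refine ⟨z, Types.ext_of_isPullback hpb ?_ ?_⟩
    · exact (ConcreteCategory.congr_hom (NatTrans.congr_app hk₁ c) z).trans h₁
    · exact (ConcreteCategory.congr_hom (NatTrans.congr_app hk₂ c) z).trans h₂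
  have := adj.leftAdjoint_preservesColimits
  have hS := ((IsPullback.of_hasPullback w' m).map L).of_iso (Iso.refl _)
    (asIso (adj.counit.app W)) eX eY (fst' := L.map (pullback.fst w' m) ≫ adj.counit.app W)
    (snd' := L.map (pullback.snd w' m) ≫ eX.hom) (Category.id_comp _).symm
    (Category.id_comp _).symm hw hm
  let e := hS.isoIsPullback _ _ hP
  have he : L.map k ≫ e.hom = adj.counit.app Z ≫ l := by
    refine hP.hom_ext ?_ ?_
    · rw [Category.assoc, hS.isoIsPullback_hom_fst, ← L.map_comp_assoc, hk₁, Category.assoc]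
      exact adj.counit_naturality _
    · rw [Category.assoc, hS.isoIsPullback_hom_snd, ← L.map_comp_assoc, hk₂, hu, Category.assoc]
  let r := regularEpiOfEpi k
  have hreg : RegularEpi (L.map k) :=
    { W := L.obj r.W
      left := L.map r.left
      right := L.map r.right
      w := by rw [← L.map_comp, r.w, L.map_comp]
      isColimit := isColimitCoforkMapOfIsColimit L r.w r.isColimit }
  exact (hreg.ofArrowIso (Arrow.isoMk (asIso (adj.counit.app Z)) e he.symm)).effectiveEpi

theorem weaklyEffectivePushouts_of_reflective (adj : L ⊣ G) [HasColimitsOfSize.{v, v} E] [HasFiniteLimits E] :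
    WeaklyEffectivePushouts E := by
  intro X₀ X₁ X₂ Y₀ Y₁ Y₂ a b c d f₀ f₁ f₂ h₀ h₂
  have := adj.leftAdjoint_preservesColimits
  have := adj.rightAdjoint_preservesLimits
  obtain ⟨eX, hX₀, hX₂⟩ := exists_iso_pushout_of_reflective adj a b
  obtain ⟨eY, hY₀, hY₂⟩ := exists_iso_pushout_of_reflective adj c d
  let m : pushout (G.map a) (G.map b) ⟶ pushout (G.map c) (G.map d) :=
    pushout.map _ _ _ _ (G.map f₀) (G.map f₂) (G.map f₁) (h₀.map G).w (h₂.map G).w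
  have hm₀ : pushout.inl _ _ ≫ m = G.map f₀ ≫ pushout.inl _ _ := pushout.inl_desc _ _ _
  have hm₂ : pushout.inr _ _ ≫ m = G.map f₂ ≫ pushout.inr _ _ := pushout.inr_desc _ _ _
  have hf₀ : pushout.inl a b ≫ pushout.map a b c d f₀ f₂ f₁ h₀.w h₂.w =
    f₀ ≫ pushout.inl _ _ := pushout.inl_desc _ _ _
  have hf₂ : pushout.inr a b ≫ pushout.map a b c d f₀ f₂ f₁ h₀.w h₂.w =
    f₂ ≫ pushout.inr _ _ := pushout.inr_desc _ _ _
  have hm : L.map m ≫ eY.hom = eX.hom ≫ pushout.map a b c d f₀ f₂ f₁ h₀.w h₂.w := by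
    refine ((IsPushout.of_hasPushout (G.map a) (G.map b)).map L).hom_ext ?_ ?_
    · rw [← L.map_comp_assoc, hm₀, L.map_comp_assoc, hY₀, reassoc_of% hX₀, hf₀]
      exact adj.counit_naturality_assoc _ _
    · rw [← L.map_comp_assoc, hm₂, L.map_comp_assoc, hY₂, reassoc_of% hX₂, hf₂]
      exact adj.counit_naturality_assoc _ _
  have ev {A₀ A₁ A₂ A₃ : C ⥤ Type v} {f : A₀ ⟶ A₁} {g : A₀ ⟶ A₂} {h : A₁ ⟶ A₃} {i : A₂ ⟶ A₃}
      (hp : IsPushout f g h i) (x : C) := hp.map ((evaluation C (Type v)).obj x)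
  have hs₀ (x : C) (y : (G.obj Y₀).obj x) (t : (pushout (G.map a) (G.map b)).obj x)
      (h : (pushout.inl (G.map c) (G.map d)).app x y = m.app x t) := exists_of_isPushout_of_isPullback
    ((h₀.map G).map ((evaluation C (Type v)).obj x)) ((h₂.map G).map ((evaluation C (Type v)).obj x))
    (ev (IsPushout.of_hasPushout (G.map a) (G.map b)) x)
    (ev (IsPushout.of_hasPushout (G.map c) (G.map d)) x)
    (NatTrans.congr_app hm₀ x) (NatTrans.congr_app hm₂ x) h
  have hs₂ (x : C) (y : (G.obj Y₂).obj x) (t : (pushout (G.map a) (G.map b)).obj x)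
      (h : (pushout.inr (G.map c) (G.map d)).app x y = m.app x t) := exists_of_isPushout_of_isPullback
    ((h₂.map G).map ((evaluation C (Type v)).obj x)) ((h₀.map G).map ((evaluation C (Type v)).obj x))
    (ev (IsPushout.of_hasPushout (G.map a) (G.map b)).flip x)
    (ev (IsPushout.of_hasPushout (G.map c) (G.map d)).flip x)
    (NatTrans.congr_app hm₂ x) (NatTrans.congr_app hm₀ x) h
  refine ⟨?_, ?_, ?_⟩
  · refine effectiveEpi_of_reflective adj (IsPullback.of_hasPullback _ _) _ hm hY₀
      (u' := pushout.inl _ _) ?_ ?_ ?_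
    · rw [pullback.lift_snd, hX₀]
    · rw [pullback.lift_fst, hm₀]
    · rw [pullback.lift_fst]
      exact hs₀
  · refine effectiveEpi_of_reflective adj (IsPullback.of_hasPullback _ _) _ hm
      (w' := G.map c ≫ pushout.inl _ _) (u' := G.map a ≫ pushout.inl _ _) ?_ ?_ ?_ ?_
    · rw [L.map_comp_assoc, hY₀]
      exact adj.counit_naturality_assoc _ _
    · rw [pullback.lift_snd, L.map_comp_assoc, hX₀]
      exact adj.counit_naturality_assoc _ _
    · rw [pullback.lift_fst, Category.assoc, hm₀, ← G.map_comp_assoc, ← G.map_comp_assoc, h₀.w]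
    · rw [pullback.lift_fst]
      intro x y t h
      -- A lift to `X₀` over the image of `y` in `Y₀` combines with `y` to a point of `X₁`, by the
      -- pullback square `h₀`.
      obtain ⟨z, hz, hz'⟩ := hs₀ x _ _ h
      obtain ⟨z', h₁, h₂⟩ := Types.exists_of_isPullback
        ((h₀.map G).map ((evaluation C (Type v)).obj x)) z y hz
      exact ⟨z', h₂, (congrArg ((pushout.inl (G.map a) (G.map b)).app x) h₁).trans hz'⟩
  · refine effectiveEpi_of_reflective adj (IsPullback.of_hasPullback _ _) _ hm hY₂
      (u' := pushout.inr _ _) ?_ ?_ ?_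
    · rw [pullback.lift_snd, hX₂]
    · rw [pullback.lift_fst, hm₂]
    · rw [pullback.lift_fst]
      exact hs₂

theorem weakDescent_of_reflective (adj : L ⊣ G) [HasColimitsOfSize.{v, v} E] [HasFiniteLimits E] :
    WeakDescent E where
  universalColimits _ _ _ := isUniversalColimit_of_reflective adj (colimit.isColimit _)
  effectiveCoproducts ι X Y f i := by
    have h : IsPullback (Sigma.ι X i) (f i) (Limits.Sigma.map f) (Sigma.ι Y i) :=
      (isVanKampenColimit_of_reflective_of_discrete adj (colimit.isColimit (Discrete.functor Y))
      (colimit.cocone (Discrete.functor X)) (Discrete.natTrans fun i => f i.as)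
      (Limits.Sigma.map f) (by
        ext j
        exact (Sigma.ι_map f j.as).symm)
      (NatTrans.Equifibered.of_discrete _)).1 ⟨colimit.isColimit _⟩ ⟨i⟩
    have : pullback.lift (f i) (Sigma.ι X i) (by simp) = h.flip.isoPullback.hom := by
      apply pullback.hom_ext <;> simp [pullback.lift_fst, pullback.lift_snd]
    rw [this]
    infer_instance
  weaklyEffectivePushouts := weaklyEffectivePushouts_of_reflective adj

end Reflective

theorem IsGrothendieckTopos.weakDescent {E : Type u} [Category.{v} E]
    [HasColimitsOfSize.{v, v} E] [HasFiniteLimits E] (h : IsGrothendieckTopos E) :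
    WeakDescent E := by
  obtain ⟨C, _, j, -, ⟨e⟩⟩ := h
  -- A coverage and the topology it generates have the same sheaves, so sheafification supplies the
  -- left exact reflector.
  have hj : IsCoverageSheaf j = Presheaf.IsSheaf j.toGrothendieck := by
    funext P
    exact propext ((Presieve.isSheaf_coverage j P).symm.trans
      (isSheaf_iff_isSheaf_of_type _ P).symm)
  rw [hj] at e
  let e' : E ≌ Sheaf j.toGrothendieck (Type v) := e
  exact weakDescent_of_reflective
    ((sheafificationAdjunction j.toGrothendieck (Type v)).comp e'.symm.toAdjunction)

end GiraudDescent

theorem mainTheorem1 (E : Type u) [CategoryTheory.Category.{v} E]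
    [CategoryTheory.IsLocallyPresentable.{v} E] :
    List.TFAE [GiraudDescent.WeakDescent E, GiraudDescent.GiraudAxioms E,
      GiraudDescent.IsGrothendieckTopos E] := by
  tfae_have 1 → 2 := GiraudDescent.WeakDescent.giraudAxioms
  tfae_have 2 → 3 := GiraudDescent.GiraudAxioms.isGrothendieckTopos
  tfae_have 3 → 1 := GiraudDescent.IsGrothendieckTopos.weakDescent
  tfae_finish
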